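/- **Setting.** Fix constants $t,\delta,C_G,c_{\mathrm{par}}>0$ and put $L_0:=t\,\delta\,C_G$. A *parameter-sphere ensemble* of parameter dimension $M$ on $\mathbb C^d$ consists of: a reference GKSL (Lindblad) generator $\mathcal L_{\mathrm{ref}}$ on $d\times d$ matrices; linear superoperators $G_1,\dots,G_M$ with $\|G_j\|_{1\to1}\le C_G$ (norm induced by the trace norm); and a measurable set $\Theta\subseteq S^{M-1}\subset\mathbb R^M$ of positive surface measure such that $$\mathcal L(\theta):=\mathcal L_{\mathrm{ref}}+\frac{\delta}{\sqrt M}\sum_{j=1}^M\theta_jG_j$$ is a GKSL generator for every $\theta\in\Theta$; together with a density matrix $\rho_{\mathrm{in}}$ and a POVM $(M_x)_{x\in X}$ on a finite set $X$. Let $\mu_\Theta$ be the normalized restriction of surface measure to $\Theta$; drawing $\mathcal L\sim\mu_{\mathcal L}$ means drawing $\theta\sim\mu_\Theta$ and taking $\mathcal L=\mathcal L(\theta)$. Put $P_{\mathcal L}(x):=\operatorname{Tr}(M_x e^{t\mathcal L}(\rho_{\mathrm{in}}))$, $P[\varphi]:=\sum_x P(x)\varphi(x)$ for $\varphi:X\to[-1,1]$,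 and let $Q:=\mathbb E_{\mathcal L\sim\mu_{\mathcal L}}P_{\mathcal L}$ be the ensemble-average distribution. Let $d_{\mathrm{TV}}(P,Q)=\frac12\sum_x|P(x)-Q(x)|$. **Assumptions.** Consider a sequence of such ensembles (with the same $t,\delta,C_G$) whose parameter dimensions $M$ tend to infinity; $d$, $X$ and the other data may vary along the sequence. Assume 1. (concentration bound) for every ensemble of the sequence and every $s>0$, $$\sup_{\varphi:X\to[-1,1]}\Pr_{\mathcal L\sim\mu_{\mathcal L}}\bigl(|P_{\mathcal L}[\varphi]-Q[\varphi]|\ge s\bigr)\le 2\exp\!\Bigl(-c_{\mathrm{par}}\frac{Ms^2}{L_0^2}\Bigr);$$ 2. (open-system Porter–Thomas mean assumption) there are a constant $m_0>0$ and errors $\epsilon_{\mathrm{mean}}>0$ tending to $0$ along the sequence with $\mathbb E_{\mathcal L\sim\mu_{\mathcal L}}d_{\mathrm{TV}}(P_{\mathcal L},Q)\in[m_0-\epsilon_{\mathrm{mean}},m_0+\epsilon_{\mathrm{mean}}]$. **Decision problem.** A statistical query (SQ) oracle for $P$ with tolerance $\tau$ is a function that answers each query $\varphi:X\to[-1,1]$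 with a real number $v$ such that $|v-P[\varphi]|\le\tau$. An SQ algorithm asks queries adaptively and then stops with one of the verdicts "$P=Q$" or "$P$ comes from the ensemble"; on input $P$ the verdict "$P=Q$" is the correct one if and only if $P=Q$. A deterministic algorithm *succeeds on $P$ with $q$ queries* if with every $\tau$-accurate oracle for $P$ it reaches the correct verdict after at most $q$ queries. A randomized algorithm is a family of deterministic algorithms indexed by a probability space (with jointly measurable moves); it *succeeds on $P$ with $q$ queries and probability $\alpha$* if with every measurable $\tau$-accurate oracle for $P$ it reaches the correct verdict after at most $q$ queries with probability at least $\alpha$ over its internal randomness. An algorithm decides $P=Q$ versus $P\sim\mu_{\mathcal L}$ *on a $\beta$-fraction* if it succeeds on $Q$, and succeeds on $P_{\mathcal L}$ for a set of Lindbladians $\mathcal L$ of $\mu_{\mathcal L}$-measure at least $\beta$. **Theorem.** For every $\tau\in(0,1)$ there is a constant $c>0$, depending only on $t,\delta,C_G,c_{\mathrm{par}}$ and $\tau$ (in particular not on $M$), such that for every sequence of ensembles satisfying 1 and 2 and every $\beta\in(0,1)$: (i) for all sufficiently large $M$ (all sufficiently late members of the sequence), every deterministic SQ algorithm that decides $P=Q$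 versus $P\sim\mu_{\mathcal L}$ on a $\beta$-fraction with at most $q$ queries of tolerance $\tau$ satisfies $q\ge\beta\exp(cM)$; (ii) for every $\alpha>\frac12$ and all sufficiently large $M$, every randomized SQ algorithm that decides $P=Q$ versus $P\sim\mu_{\mathcal L}$ on a $\beta$-fraction with success probability at least $\alpha$ and at most $q$ queries of tolerance $\tau$ satisfies $q\ge(\alpha-\frac12)\,\beta\exp(cM)$. -/

import Mathlib

open MeasureTheory Filter Topology
open scoped ComplexOrder

noncomputable section

namespace LindbladSQ

/-! ### Operators, superoperators and Lindblad generators -/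

/-- Operators on the Hilbert space `ℂ^d`. -/
abbrev Op (d : ℕ) : Type := Matrix (Fin d) (Fin d) ℂ

/-- Superoperators: complex-linear maps on the operators on `ℂ^d`. -/
abbrev SuperOp (d : ℕ) : Type := Module.End ℂ (Op d)

/-- The trace norm (Schatten 1-norm): the sum of the singular values. -/
def traceNorm {d : ℕ} (A : Op d) : ℝ :=
  ∑ i : Fin d, (Matrix.toEuclideanLin A).singularValues (i : ℕ)

/-- The superoperator norm `‖T‖_{1→1} = sup_{A ≠ 0} ‖T A‖₁ / ‖A‖₁`, as an extended
nonnegative real number. -/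
def oneToOneNorm {d : ℕ} (T : SuperOp d) : ENNReal :=
  ⨆ (A : Op d) (_ : A ≠ 0), ENNReal.ofReal (traceNorm (T A) / traceNorm A)

/-- GKSL (Lindblad) generators:
`L ρ = -i [H, ρ] + ∑ k, γ k (J k ρ (J k)† - ½ {(J k)† J k, ρ})`
with `H` Hermitian, finitely many jump operators `J k`, and rates `γ k ≥ 0`. -/
def IsGKSL {d : ℕ} (L : SuperOp d) : Prop :=
  ∃ (H : Op d) (m : ℕ) (γ : Fin m → ℝ) (J : Fin m → Op d),
    H.IsHermitian ∧ (∀ k, 0 ≤ γ k) ∧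
    ∀ ρ : Op d,
      L ρ = -Complex.I • (H * ρ - ρ * H) +
        ∑ k, γ k • (J k * ρ * (J k).conjTranspose -
          (1 / 2 : ℝ) • ((J k).conjTranspose * J k * ρ + ρ * ((J k).conjTranspose * J k)))

/-- The element `Λ_t = e^{tL}` of the semigroup generated by `L`, computed as a matrix exponential
in the basis of matrix units. -/
def semigroup {d : ℕ} (L : SuperOp d) (t : ℝ) : SuperOp d :=
  Matrix.toLin (Matrix.stdBasis ℂ (Fin d) (Fin d)) (Matrix.stdBasis ℂ (Fin d) (Fin d))
    (NormedSpace.exp (t • LinearMap.toMatrix (Matrix.stdBasis ℂ (Fin d) (Fin d))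
      (Matrix.stdBasis ℂ (Fin d) (Fin d)) L))

/-- Density operators. -/
def IsDensity {d : ℕ} (ρ : Op d) : Prop := ρ.PosSemidef ∧ ρ.trace = 1

/-- Positive operator valued measures with finite outcome set `X`. -/
def IsPOVM {d : ℕ} {X : Type*} [Fintype X] (E : X → Op d) : Prop :=
  (∀ x, (E x).PosSemidef) ∧ ∑ x, E x = 1

/-! ### Statistical queries -/

/-- Query functions `φ : X → [-1, 1]`. -/
abbrev Query (X : Type*) : Type _ := X → Set.Icc (-1 : ℝ) 1

section SQ

variable {X : Type*} [Fintype X]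

/-- `P[φ] = ∑ x, P x * φ x`. -/
def expect (P : X → ℝ) (φ : Query X) : ℝ := ∑ x, P x * (φ x : ℝ)

/-- Total variation distance. -/
def tvDist (P Q : X → ℝ) : ℝ := (1 / 2) * ∑ x, |P x - Q x|

/-- `O` is a statistical query oracle for `P` with tolerance `τ`. -/
def IsStatOracle (τ : ℝ) (P : X → ℝ) (O : Query X → ℝ) : Prop :=
  ∀ φ, |O φ - expect P φ| ≤ τ

/-- A deterministic adaptive statistical query decision algorithm. Having received the answers
`h 0, …, h (k - 1)` to its first `k` queries it either asks a further query or stops with a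
verdict; `true` means "`P = Q`", `false` means "`P` comes from the ensemble". -/
structure SQAlgorithm (X : Type*) where
  step : (k : ℕ) → (Fin k → ℝ) → Query X ⊕ Bool

/-- Continue the run of `A` with oracle `O` after `k` queries answered by `h`, allowing at most
`fuel` further queries; `none` if there is no verdict by then. -/
def SQAlgorithm.runFrom (A : SQAlgorithm X) (O : Query X → ℝ) :
    (fuel : ℕ) → (k : ℕ) → (Fin k → ℝ) → Option Bool
  | 0, k, h =>
    match A.step k h with
    | Sum.inl _ => none
    | Sum.inr b => some b
  | fuel + 1, k, h =>
    match A.step k h with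
    | Sum.inl φ => A.runFrom O fuel (k + 1) (Fin.snoc h (O φ))
    | Sum.inr b => some b

/-- The verdict that `A` reaches with oracle `O` within at most `q` queries, if any. -/
def SQAlgorithm.run (A : SQAlgorithm X) (O : Query X → ℝ) (q : ℕ) : Option Bool :=
  A.runFrom O q 0 Fin.elim0

open Classical in
/-- The correct verdict on `P`: "`P = Q`" precisely when `P = Q`. -/
def correctVerdict (P Q : X → ℝ) : Bool := decide (P = Q)

/-- With every `τ`-accurate oracle for `P`, the algorithm reaches the correct verdict within `q`
queries. -/
def SQAlgorithm.Correct (A : SQAlgorithm X) (τ : ℝ) (q : ℕ) (Q P : X → ℝ) : Prop :=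
  ∀ O : Query X → ℝ, IsStatOracle τ P O → A.run O q = some (correctVerdict P Q)

/-- A randomized algorithm: a family of deterministic ones indexed by the internal randomness `ω`,
whose next move is jointly measurable in `ω` and the answers received. -/
structure RandomizedSQAlgorithm (Ω : Type*) [MeasurableSpace Ω] (X : Type*) where
  alg : Ω → SQAlgorithm X
  measurable_step : ∀ k : ℕ, Measurable fun p : Ω × (Fin k → ℝ) => (alg p.1).step k p.2

/-- With every (measurable) `τ`-accurate oracle for `P`, the randomized algorithm reaches the
correct verdict within `q` queries with probability at least `α` over its randomness. -/
def RandomizedSQAlgorithm.Correct {Ω : Type*} [MeasurableSpace Ω]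
    (A : RandomizedSQAlgorithm Ω X) (ℙ : Measure Ω) (τ : ℝ) (q : ℕ) (α : ℝ)
    (Q P : X → ℝ) : Prop :=
  ∀ O : Query X → ℝ, Measurable O → IsStatOracle τ P O →
    α ≤ ℙ.real {ω | (A.alg ω).run O q = some (correctVerdict P Q)}

end SQ

/-! ### Random Lindbladian ensembles on the parameter sphere -/

/-- The unit sphere `S^{M-1}` in `ℝ^M`. -/
abbrev ParamSphere (M : ℕ) : Type := Metric.sphere (0 : EuclideanSpace ℝ (Fin M)) 1

/-- The (not normalized) rotation-invariant surface measure on `S^{M-1}`. -/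
def sphereMeasure (M : ℕ) : Measure (ParamSphere M) :=
  (volume : Measure (EuclideanSpace ℝ (Fin M))).toSphere

/-- A parameter-sphere ensemble of Lindbladians on `ℂ^d` together with a measurement interface with
outcome set `X`: generators `L(θ) = Lref + (δ / √M) ∑ j, θ j • G j` with `‖G j‖_{1→1} ≤ C_G`, for
`θ` in a region `Θ` of positive measure of the sphere on which `L(θ)` is a GKSL generator, evolution
time `t`, an input state and a POVM. -/
structure SphereEnsemble (M d : ℕ) (X : Type*) [Fintype X] (t δ C_G : ℝ) where
  Lref : SuperOp d
  G : Fin M → SuperOp d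
  Θ : Set (ParamSphere M)
  ρin : Op d
  povm : X → Op d
  Lref_gksl : IsGKSL Lref
  G_bound : ∀ j, oneToOneNorm (G j) ≤ ENNReal.ofReal C_G
  Θ_measurable : MeasurableSet Θ
  Θ_pos : sphereMeasure M Θ ≠ 0
  gksl : ∀ θ ∈ Θ, IsGKSL (Lref + (δ / √(M : ℝ)) • ∑ j, (θ : EuclideanSpace ℝ (Fin M)) j • G j)
  ρin_density : IsDensity ρin
  povm_isPOVM : IsPOVM povm

namespace SphereEnsemble

variable {M d : ℕ} {X : Type*} [Fintype X] {t δ C_G : ℝ}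

/-- The generator `L(θ) = Lref + (δ / √M) ∑ j, θ j • G j`. -/
def generator (E : SphereEnsemble M d X t δ C_G) (θ : ParamSphere M) : SuperOp d :=
  E.Lref + (δ / √(M : ℝ)) • ∑ j, (θ : EuclideanSpace ℝ (Fin M)) j • E.G j

/-- The output distribution `P_{L(θ)}(x) = Tr (M_x e^{t L(θ)}(ρin))`. The trace is real, and this is
a probability distribution, whenever `L(θ)` is a GKSL generator. -/
def outputDist (E : SphereEnsemble M d X t δ C_G) (θ : ParamSphere M) (x : X) : ℝ :=
  (E.povm x * semigroup (E.generator θ) t E.ρin).trace.re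

/-- The law of `θ`: surface measure restricted to `Θ` and normalized. Sampling a Lindbladian from
the ensemble means sampling `θ` from this law and taking `L(θ)`. -/
def paramLaw (E : SphereEnsemble M d X t δ C_G) : Measure (ParamSphere M) :=
  ProbabilityTheory.cond (sphereMeasure M) E.Θ

/-- The reference distribution `Q`: the ensemble average of the output distributions. -/
def refDist (E : SphereEnsemble M d X t δ C_G) (x : X) : ℝ :=
  ∫ θ, E.outputDist θ x ∂E.paramLaw

/-- The maximally distinguishable fraction
`sup_φ Pr_θ (|P_{L(θ)}[φ] - Q[φ]| ≥ s)`. -/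
def frac (E : SphereEnsemble M d X t δ C_G) (s : ℝ) : ENNReal :=
  ⨆ φ : Query X, E.paramLaw {θ | s ≤ |expect (E.outputDist θ) φ - expect E.refDist φ|}

/-- The concentration bound `frac(s) ≤ 2 exp (-c_par M s² / L₀²)` for all `s > 0`, where
`L₀ = t δ C_G`. -/
def ConcentrationBound (E : SphereEnsemble M d X t δ C_G) (c_par : ℝ) : Prop :=
  ∀ s : ℝ, 0 < s →
    E.frac s ≤ ENNReal.ofReal (2 * Real.exp (-(c_par * (M * s ^ 2 / (t * δ * C_G) ^ 2))))

/-- The mean total variation distance between the output distribution and `Q`. -/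
def meanTV (E : SphereEnsemble M d X t δ C_G) : ℝ :=
  ∫ θ, tvDist (E.outputDist θ) E.refDist ∂E.paramLaw

/-- The deterministic algorithm `A`, using at most `q` queries of tolerance `τ`, correctly decides
between `P = Q` and `P` from the ensemble on a `β`-fraction of the Lindbladians: it is correct on
`Q`, and on `P_L` for a set of Lindbladians `L` of measure at least `β`. -/
def DetDecides (E : SphereEnsemble M d X t δ C_G) (A : SQAlgorithm X)
    (τ : ℝ) (q : ℕ) (β : ℝ) : Prop :=
  A.Correct τ q E.refDist E.refDist ∧
    β ≤ E.paramLaw.real {θ | A.Correct τ q E.refDist (E.outputDist θ)}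

/-- The same for a randomized algorithm with success probability at least `α` over its internal
randomness. -/
def RandDecides (E : SphereEnsemble M d X t δ C_G) {Ω : Type*} [MeasurableSpace Ω]
    (ℙ : Measure Ω) (A : RandomizedSQAlgorithm Ω X) (τ : ℝ) (q : ℕ) (α β : ℝ) : Prop :=
  A.Correct ℙ τ q α E.refDist E.refDist ∧
    β ≤ E.paramLaw.real {θ | A.Correct ℙ τ q α E.refDist (E.outputDist θ)}

end SphereEnsemble

/-- The open-system Porter–Thomas mean assumption for a sequence of ensembles: the mean total
variation distance to `Q` lies within `ε n → 0` of a constant `m₀ > 0`. -/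
def PorterThomasMean {M d : ℕ → ℕ} {X : ℕ → Type*} [∀ n, Fintype (X n)] {t δ C_G : ℝ}
    (E : ∀ n, SphereEnsemble (M n) (d n) (X n) t δ C_G) : Prop :=
  ∃ m₀ : ℝ, 0 < m₀ ∧ ∃ ε : ℕ → ℝ, (∀ n, 0 < ε n) ∧ Tendsto ε atTop (𝓝 0) ∧
    ∀ n, (E n).meanTV ∈ Set.Icc (m₀ - ε n) (m₀ + ε n)

end LindbladSQ

end

/-! Run a correct algorithm with the exact oracle for `Q`, and compare with an oracle for `P` that
copies the answers for `Q` whenever the tolerance allows it. If `P ≠ Q` the verdicts must differ, so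
the run on `Q` asks a query separating `P` from `Q` by more than `τ`. That run does not depend on
`P`. Averaged over the ensemble, each of its at most `q` queries separates with probability at most
`frac τ`, so `β ≤ q * frac τ`, and the concentration bound finishes. For randomized algorithms both
verdicts are correct for the same randomness with probability at least `2α - 1`; Markov's inequality
and Tonelli give `(2α - 1) β ≤ q * frac τ`.

The argument needs `P_L ≠ Q` almost surely, and a positive mean distance only gives `P_L ≠ Q`
somewhere. Output probabilities are real-analytic in `θ`, so one such point suffices: on a sphere of
dimension at least one, a nonzero analytic function has a null zero set
(`toSphere_zeroSet_eq_zero`). -/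

noncomputable section

namespace LindbladSQ

/-! ### Zero sets of analytic functions on the sphere -/

section AnalyticSphere

variable {V : Type*} [NormedAddCommGroup V] [InnerProductSpace ℝ V] [FiniteDimensional ℝ V]
  [MeasurableSpace V] [BorelSpace V] (μ : Measure V) [μ.IsAddHaarMeasure]

/-- A measurable set that meets every line through the origin in a null set is a null set. -/
theorem measure_eq_zero_of_ae_smul_notMem {S : Set V} (hS : MeasurableSet S)
    (h : ∀ y : V, ∀ᵐ r : ℝ, r • y ∉ S) : μ S = 0 := by
  have hT : MeasurableSet {p : V × ℝ | p.2 • p.1 ∈ S} :=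
    (measurable_snd.smul measurable_fst) hS
  -- Fubini in both orders: null fibres over each `y` give some `r ≠ 0` for which the preimage of
  -- `S` under scaling by `r` is null, and Haar measure scales by a nonzero factor.
  have h0 : (μ.prod volume) {p : V × ℝ | p.2 • p.1 ∈ S} = 0 := by
    rw [Measure.measure_prod_null hT]
    refine Eventually.of_forall fun y => ?_
    have := h y
    rw [ae_iff] at this
    simpa using this
  rw [← Measure.prod_swap, Measure.map_apply measurable_swap hT,
    Measure.measure_prod_null (measurable_swap hT)] at h0
  have h1 : ∀ᵐ r : ℝ, r ≠ 0 := by simp [ae_iff]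
  obtain ⟨r, hr, hr0⟩ := (h0.and h1).exists
  have hr' : μ ((r • ·) ⁻¹' S) = 0 := hr
  rw [Measure.addHaar_preimage_smul μ hr0] at hr'
  rcases mul_eq_zero.1 hr' with h2 | h2
  · simp [hr0] at h2
  · exact h2

omit [FiniteDimensional ℝ V] [MeasurableSpace V] [BorelSpace V] in
/-- Along a line missing the origin, an analytic function of the direction is analytic. -/
theorem analyticAt_comp_normalize_line {F : V → ℝ} (hF : AnalyticOnNhd ℝ F Set.univ) {p y : V}
    {r : ℝ} (h : p + r • y ≠ 0) :
    AnalyticAt ℝ (fun s : ℝ => F (‖p + s • y‖⁻¹ • (p + s • y))) r := by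
  have hl : AnalyticAt ℝ (fun s : ℝ => p + s • y) r := by fun_prop
  have hn : AnalyticAt ℝ (fun s : ℝ => ‖p + s • y‖) r := by
    have : AnalyticAt ℝ (fun x : V => ‖x‖) (p + r • y) :=
      (contDiffAt_norm ℝ h (n := ⊤)).analyticAt
    exact AnalyticAt.fun_comp (f := fun s : ℝ => p + s • y) this hl
  exact AnalyticAt.fun_comp (hF _ (Set.mem_univ _)) ((hn.inv (by simpa using h)).smul hl)

open scoped Pointwise in
/-- On the unit sphere of a space of dimension at least two, an analytic function that does not
vanish identically has a null zero set. -/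
theorem toSphere_zeroSet_eq_zero {F : V → ℝ} (hF : AnalyticOnNhd ℝ F Set.univ)
    (hdim : 2 ≤ Module.finrank ℝ V) {p : V} (hp : ‖p‖ = 1) (hFp : F p ≠ 0) :
    μ.toSphere {θ | F θ = 0} = 0 := by
  have hFc : Continuous F := continuous_iff_continuousAt.2 fun x =>
    (hF x (Set.mem_univ _)).continuousAt
  -- Off the null line `K`, the line `p + r • y` misses the origin and so can be projected radially
  -- to the sphere.
  set K : Submodule ℝ V := Submodule.span ℝ {p}
  have hpK : p ∈ K := Submodule.mem_span_singleton_self p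
  have hK : μ (K : Set V) = 0 := by
    refine Measure.addHaar_submodule μ K fun hKt => ?_
    have h1 : Module.finrank ℝ K ≤ 1 := by
      simpa using finrank_span_le_card (R := ℝ) ({p} : Set V)
    rw [hKt, finrank_top] at h1
    omega
  have hKm : MeasurableSet (K : Set V) := K.closed_of_finiteDimensional.measurableSet
  have hgm : Measurable fun x : V => F (‖x‖⁻¹ • x) :=
    hFc.measurable.comp (measurable_norm.inv.smul measurable_id)
  set S : Set V := {y | y ∉ K ∧ F (‖p + y‖⁻¹ • (p + y)) = 0}
  have hSm : MeasurableSet S :=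
    hKm.compl.inter ((hgm.comp (measurable_const_add p)) (measurableSet_singleton 0))
  have hS : μ S = 0 := by
    refine measure_eq_zero_of_ae_smul_notMem μ hSm fun y => ?_
    by_cases hy : y ∈ K
    · exact Eventually.of_forall fun r hr => hr.1 (K.smul_mem r hy)
    · have hne : ∀ r : ℝ, p + r • y ≠ 0 := by
        intro r h0
        rcases eq_or_ne r 0 with rfl | hr
        · simp only [zero_smul, add_zero] at h0
          simp [h0] at hp
        · refine hy ?_
          have h1 : r • y ∈ K := by
            rw [show r • y = -p from (neg_eq_of_add_eq_zero_right h0).symm]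
            exact K.neg_mem hpK
          exact (K.smul_mem_iff hr).1 h1
      have han : AnalyticOnNhd ℝ (fun s : ℝ => F (‖p + s • y‖⁻¹ • (p + s • y))) Set.univ :=
        fun r _ => analyticAt_comp_normalize_line hF (hne r)
      -- At `s = 0` the function takes the value `F p ≠ 0`, so its zeros on the line are isolated.
      have hcod := han.preimage_zero_mem_codiscrete (x := 0) (by simpa [hp] using hFp)
      have hae := ae_restrict_le_codiscreteWithin MeasurableSet.univ (μ := (volume : Measure ℝ))
        hcod
      rw [Measure.restrict_univ] at hae
      filter_upwards [hae] with r hr hrS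
      exact hr hrS.2
  have hZ : MeasurableSet {θ : Metric.sphere (0 : V) 1 | F θ = 0} :=
    (hFc.measurable.comp measurable_subtype_coe) (measurableSet_singleton 0)
  rw [Measure.toSphere_apply' μ hZ]
  -- Surface measure is a multiple of the volume of the cone over the set; translating the cone by
  -- `-p` puts it inside `S ∪ K`.
  have hsub : Set.Ioo (0 : ℝ) 1 • ((↑) '' {θ : Metric.sphere (0 : V) 1 | F θ = 0})
      ⊆ ((fun x => -p + x) ⁻¹' S) ∪ ((fun x => -p + x) ⁻¹' (K : Set V)) := by
    rintro _ ⟨r, hr, _, ⟨θ, hθ, rfl⟩, rfl⟩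
    by_cases h : -p + r • (θ : V) ∈ K
    · exact Or.inr h
    · refine Or.inl ⟨h, ?_⟩
      have hn : ‖(θ : V)‖ = 1 := by simp
      have : p + (-p + r • (θ : V)) = r • (θ : V) := by abel
      simp only [this, norm_smul, hn, mul_one, Real.norm_eq_abs, abs_of_pos hr.1, smul_smul,
        inv_mul_cancel₀ hr.1.ne', one_smul]
      exact hθ
  rw [measure_mono_null hsub (measure_union_null (by rwa [measure_preimage_add])
    (by rwa [measure_preimage_add])), mul_zero]

end AnalyticSphere

/-! ### Analyticity of the output distribution -/

section

-- The choice of norm is immaterial; a normed algebra structure is needed for the exponential to be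
-- analytic.
attribute [local instance] Matrix.linftyOpNormedRing Matrix.linftyOpNormedAlgebra

/-- Composing the matrix exponential with real-linear maps from and to real normed spaces gives an
analytic function. -/
theorem analyticOnNhd_linear_exp_affine {ι V : Type*} [Fintype ι] [DecidableEq ι]
    [NormedAddCommGroup V] [NormedSpace ℝ V] [FiniteDimensional ℝ V]
    (φ : Matrix ι ι ℂ →ₗ[ℝ] ℝ) (A : Matrix ι ι ℂ) (B : V →ₗ[ℝ] Matrix ι ι ℂ) :
    AnalyticOnNhd ℝ (fun v => φ (NormedSpace.exp (A + B v))) Set.univ := by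
  intro v _
  have hB : AnalyticAt ℝ (fun v => A + B v) v :=
    analyticAt_const.add (B.toContinuousLinearMap.analyticAt v)
  have hexp : AnalyticAt ℝ (NormedSpace.exp : Matrix ι ι ℂ → Matrix ι ι ℂ) (A + B v) :=
    NormedSpace.exp_analytic (𝕂 := ℝ) _
  have hφ := φ.toContinuousLinearMap.analyticAt (NormedSpace.exp (A + B v))
  exact AnalyticAt.fun_comp (f := fun v => NormedSpace.exp (A + B v)) hφ
    (AnalyticAt.fun_comp (f := fun v => A + B v) hexp hB)

end

namespace SphereEnsemble

variable {M d : ℕ} {X : Type*} [Fintype X] {t δ C_G : ℝ}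

/-- The output probabilities extend to real-analytic functions on the whole parameter space. -/
theorem exists_analytic_extension (E : SphereEnsemble M d X t δ C_G) (x : X) :
    ∃ F : EuclideanSpace ℝ (Fin M) → ℝ, AnalyticOnNhd ℝ F Set.univ ∧
      ∀ θ : ParamSphere M, E.outputDist θ x = F θ := by
  let b := Matrix.stdBasis ℂ (Fin d) (Fin d)
  let φ : Matrix (Fin d × Fin d) (Fin d × Fin d) ℂ →ₗ[ℝ] ℝ :=
    { toFun := fun N => (E.povm x * Matrix.toLin b b N E.ρin).trace.re
      map_add' := fun N N' => by simp [Matrix.mul_add]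
      map_smul' := fun r N => by
        have h : r • N = (r : ℂ) • N := by ext; simp
        rw [h, map_smul, LinearMap.smul_apply, Matrix.mul_smul, Matrix.trace_smul]
        simp }
  let B : EuclideanSpace ℝ (Fin M) →ₗ[ℝ] Matrix (Fin d × Fin d) (Fin d × Fin d) ℂ :=
    { toFun := fun v => t • LinearMap.toMatrix b b ((δ / √(M : ℝ)) • ∑ j, v j • E.G j)
      map_add' := fun v w => by
        simp only [PiLp.add_apply, add_smul, Finset.sum_add_distrib, smul_add, map_add]
      map_smul' := fun r v => by
        have h : (δ / √(M : ℝ)) • ∑ j, (r • v) j • E.G j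
            = (r : ℂ) • ((δ / √(M : ℝ)) • ∑ j, v j • E.G j) := by
          have h' : ∀ T : SuperOp d, (r : ℂ) • T = r • T := fun T => by ext; simp
          rw [h', smul_comm r]
          simp only [PiLp.smul_apply, smul_eq_mul, mul_smul, Finset.smul_sum]
        simp only [h, map_smul, RingHom.id_apply]
        ext
        simp
        ring }
  refine ⟨_, analyticOnNhd_linear_exp_affine φ (t • LinearMap.toMatrix b b E.Lref) B, fun θ => ?_⟩
  simp only [outputDist, semigroup, generator, map_add, smul_add]
  rfl

theorem measurable_outputDist (E : SphereEnsemble M d X t δ C_G) (x : X) :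
    Measurable fun θ => E.outputDist θ x := by
  obtain ⟨F, hF, hFE⟩ := E.exists_analytic_extension x
  have hFc : Continuous F := continuous_iff_continuousAt.2 fun v =>
    (hF v (Set.mem_univ _)).continuousAt
  simp only [hFE]
  exact hFc.measurable.comp measurable_subtype_coe

/-- If the mean total variation distance to the ensemble average is positive, then the output
distribution differs from the ensemble average almost surely. -/
theorem paramLaw_eq_refDist_eq_zero (E : SphereEnsemble M d X t δ C_G) (hM : 2 ≤ M)
    (hE : 0 < E.meanTV) : E.paramLaw {θ | E.outputDist θ = E.refDist} = 0 := by
  -- The point `p` may lie outside `Θ`: the analytic extension covers the whole sphere.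
  obtain ⟨p, hp⟩ : ∃ p, E.outputDist p ≠ E.refDist := by
    by_contra! h
    simp [meanTV, h, tvDist] at hE
  obtain ⟨x, hx⟩ := Function.ne_iff.1 hp
  obtain ⟨F, hF, hFE⟩ := E.exists_analytic_extension x
  have h0 : sphereMeasure M {θ | F θ - E.refDist x = 0} = 0 :=
    toSphere_zeroSet_eq_zero _ (F := fun v => F v - E.refDist x)
      (fun v hv => (hF v hv).sub analyticAt_const) (by simpa using hM)
      (p := (p : EuclideanSpace ℝ (Fin M))) (by simp)
      (by rw [← hFE]; exact sub_ne_zero.2 hx)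
  refine ProbabilityTheory.cond_absolutelyContinuous (measure_mono_null (fun θ hθ => ?_) h0)
  have h1 : E.outputDist θ = E.refDist := hθ
  simp [← hFE, h1]

instance (E : SphereEnsemble M d X t δ C_G) : IsProbabilityMeasure E.paramLaw :=
  have : IsFiniteMeasure (sphereMeasure M) := by unfold sphereMeasure; infer_instance
  ProbabilityTheory.cond_isProbabilityMeasure E.Θ_pos

end SphereEnsemble

/-! ### Runs of statistical query algorithms -/

section Runs

open scoped ENNReal

variable {X : Type*} [Fintype X]

/-- The total weight `∑ D φ` of the queries `φ` asked by `A` with oracle `O` after `k` queries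
answered by `h`, during at most `fuel` further queries. -/
def SQAlgorithm.queryWeight (A : SQAlgorithm X) (O : Query X → ℝ) (D : Query X → ℝ≥0∞) :
    (fuel : ℕ) → (k : ℕ) → (Fin k → ℝ) → ℝ≥0∞
  | 0, _, _ => 0
  | fuel + 1, k, h =>
    Sum.elim (fun φ => D φ + A.queryWeight O D fuel (k + 1) (Fin.snoc h (O φ))) (fun _ => 0)
      (A.step k h)

omit [Fintype X] in
/-- If every query on which two oracles differ has weight at least one, then two runs with
different outcomes have asked queries of total weight at least one. -/
theorem SQAlgorithm.one_le_queryWeight (A : SQAlgorithm X) {O O' : Query X → ℝ}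
    {D : Query X → ℝ≥0∞} (hD : ∀ φ, O φ ≠ O' φ → 1 ≤ D φ) (fuel k : ℕ) (h : Fin k → ℝ)
    (hne : A.runFrom O fuel k h ≠ A.runFrom O' fuel k h) :
    1 ≤ A.queryWeight O D fuel k h := by
  induction fuel generalizing k with
  | zero => exact absurd rfl hne
  | succ fuel ih =>
    rw [queryWeight]
    rw [runFrom, runFrom] at hne
    cases hs : A.step k h with
    | inr b => simp [hs] at hne
    | inl φ =>
      simp only [hs] at hne
      -- Equal answers keep the two histories equal; the first unequal answer already contributes
      -- weight one.
      by_cases hφ : O φ = O' φ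
      · rw [← hφ] at hne
        exact (ih _ _ hne).trans le_add_self
      · exact (hD φ hφ).trans le_self_add

/-! ### Measurability of randomized runs. -/

theorem measurable_expect : Measurable fun p : (X → ℝ) × Query X => expect p.1 p.2 := by
  unfold expect
  fun_prop

/-- Used to branch on an algorithm's next move, by distributing `Y` over the sum `α ⊕ β`. -/
theorem measurable_sumElim_prod {Y α β γ : Type*} [MeasurableSpace Y] [MeasurableSpace α]
    [MeasurableSpace β] [MeasurableSpace γ] {f : Y → α → γ} {g : Y → β → γ} {s : Y → α ⊕ β}
    (hf : Measurable (Function.uncurry f)) (hg : Measurable (Function.uncurry g))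
    (hs : Measurable s) : Measurable fun y => Sum.elim (f y) (g y) (s y) := by
  have h : Measurable fun p : Y × (α ⊕ β) => Sum.elim (f p.1) (g p.1) p.2 := by
    rw [← (MeasurableEquiv.prodSumDistrib Y α β).symm.measurable_comp_iff]
    refine measurable_fun_sum ?_ ?_
    · exact hf
    · exact hg
  exact h.comp (measurable_id.prodMk hs)

theorem measurable_finSnoc {Y : Type*} [MeasurableSpace Y] {k : ℕ} {h : Y → Fin k → ℝ} {a : Y → ℝ}
    (hh : Measurable h) (ha : Measurable a) :
    Measurable fun y => (Fin.snoc (h y) (a y) : Fin (k + 1) → ℝ) := by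
  refine measurable_pi_iff.2 fun i => ?_
  refine Fin.lastCases ?_ (fun j => ?_) i
  · simpa using ha
  · simpa only [Fin.snoc_castSucc] using measurable_pi_iff.1 hh j

variable {Ω : Type*} [MeasurableSpace Ω] (A : RandomizedSQAlgorithm Ω X)

namespace RandomizedSQAlgorithm

-- Joint measurability in randomness and parameter is what Tonelli requires later. The history stays
-- a variable because the induction appends answers that depend on `ω`.
omit [Fintype X] in
theorem measurable_queryWeight {T : Type*} [MeasurableSpace T] {O : Query X → ℝ}
    (hO : Measurable O) {D : T → Query X → ℝ≥0∞} (hD : Measurable fun p : T × Query X => D p.1 p.2)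
    (fuel k : ℕ) :
    Measurable fun p : (Ω × T) × (Fin k → ℝ) =>
      (A.alg p.1.1).queryWeight O (D p.1.2) fuel k p.2 := by
  induction fuel generalizing k with
  | zero => exact measurable_const
  | succ fuel ih =>
    simp only [SQAlgorithm.queryWeight]
    refine measurable_sumElim_prod ?_ measurable_const ((A.measurable_step k).comp
      ((measurable_fst.comp measurable_fst).prodMk measurable_snd))
    refine Measurable.add (hD.comp
      ((measurable_snd.comp (measurable_fst.comp measurable_fst)).prodMk measurable_snd)) ?_
    exact (ih (k + 1)).comp ((measurable_fst.comp measurable_fst).prodMk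
      (measurable_finSnoc (measurable_snd.comp measurable_fst) (hO.comp measurable_snd)))

omit [Fintype X] in
theorem measurableSet_runFrom_eq {O : Query X → ℝ} (hO : Measurable O) (v : Option Bool)
    (fuel k : ℕ) :
    MeasurableSet {p : Ω × (Fin k → ℝ) | (A.alg p.1).runFrom O fuel k p.2 = v} := by
  refine measurableSet_setOfPred.2 ?_
  induction fuel generalizing k with
  | zero =>
    have h : (fun p : Ω × (Fin k → ℝ) => (A.alg p.1).runFrom O 0 k p.2 = v)
        = fun p => Sum.elim (fun _ => none = v) (fun b => some b = v) ((A.alg p.1).step k p.2) := by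
      funext p
      rw [SQAlgorithm.runFrom]
      cases (A.alg p.1).step k p.2 <;> rfl
    rw [h]
    exact measurable_sumElim_prod measurable_const
      ((measurable_of_finite fun b : Bool => (some b = v : Prop)).comp measurable_snd)
      (A.measurable_step k)
  | succ fuel ih =>
    have h : (fun p : Ω × (Fin k → ℝ) => (A.alg p.1).runFrom O (fuel + 1) k p.2 = v)
        = fun p => Sum.elim
          (fun φ => (A.alg p.1).runFrom O fuel (k + 1) (Fin.snoc p.2 (O φ)) = v)
          (fun b => some b = v) ((A.alg p.1).step k p.2) := by
      funext p
      rw [SQAlgorithm.runFrom]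
      cases (A.alg p.1).step k p.2 <;> rfl
    rw [h]
    refine measurable_sumElim_prod ?_
      ((measurable_of_finite fun b : Bool => (some b = v : Prop)).comp measurable_snd)
      (A.measurable_step k)
    exact (ih (k + 1)).comp ((measurable_fst.comp measurable_fst).prodMk
      (measurable_finSnoc (measurable_snd.comp measurable_fst) (hO.comp measurable_snd)))

omit [Fintype X] in
theorem measurableSet_run_eq {O : Query X → ℝ} (hO : Measurable O) (v : Option Bool) (q : ℕ) :
    MeasurableSet {ω | (A.alg ω).run O q = v} :=
  measurable_prodMk_right (A.measurableSet_runFrom_eq hO v q 0)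

end RandomizedSQAlgorithm

omit [Fintype X] in
/-- Query weights that have small mean for every fixed query have small mean total weight. -/
theorem SQAlgorithm.lintegral_queryWeight_le {T : Type*} [MeasurableSpace T] (μ : Measure T)
    (A : SQAlgorithm X) (O : Query X → ℝ) {D : T → Query X → ℝ≥0∞}
    (hD : ∀ φ, Measurable fun θ => D θ φ) {e : ℝ≥0∞} (he : ∀ φ, ∫⁻ θ, D θ φ ∂μ ≤ e)
    (fuel k : ℕ) (h : Fin k → ℝ) :
    ∫⁻ θ, A.queryWeight O (D θ) fuel k h ∂μ ≤ fuel * e := by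
  induction fuel generalizing k with
  | zero => simp [queryWeight]
  | succ fuel ih =>
    simp only [queryWeight]
    -- The answers come from the fixed oracle `O`, so the next query does not depend on `θ` and the
    -- hypothesis on single queries applies.
    cases A.step k h with
    | inr b => simp
    | inl φ =>
      simp only [Sum.elim_inl]
      rw [lintegral_add_left (hD φ), Nat.cast_succ, add_mul, one_mul, add_comm]
      exact add_le_add (ih _ _) (he φ)

omit [Fintype X] in
theorem SQAlgorithm.measurable_queryWeight {T : Type*} [MeasurableSpace T] (A : SQAlgorithm X)
    (O : Query X → ℝ) {D : T → Query X → ℝ≥0∞} (hD : ∀ φ, Measurable fun θ => D θ φ)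
    (fuel k : ℕ) (h : Fin k → ℝ) : Measurable fun θ => A.queryWeight O (D θ) fuel k h := by
  induction fuel generalizing k with
  | zero => exact measurable_const
  | succ fuel ih =>
    simp only [queryWeight]
    cases A.step k h with
    | inr b => exact measurable_const
    | inl φ => exact (hD φ).add (ih _ _)

/-- The indicator of the queries that distinguish `P` from `Q` at tolerance `τ`. -/
def distinguish (τ : ℝ) (Q P : X → ℝ) : Query X → ℝ≥0∞ :=
  {φ | τ < |expect P φ - expect Q φ|}.indicator 1

open Classical in
/-- The oracle for `P` that answers as if for `Q` whenever the tolerance allows this. -/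
def confusingOracle (τ : ℝ) (Q P : X → ℝ) (φ : Query X) : ℝ :=
  if τ < |expect P φ - expect Q φ| then expect P φ else expect Q φ

theorem measurable_expect_right (P : X → ℝ) : Measurable (expect P) :=
  measurable_expect.comp (measurable_const.prodMk measurable_id)

theorem isStatOracle_expect {τ : ℝ} (hτ : 0 ≤ τ) (P : X → ℝ) : IsStatOracle τ P (expect P) :=
  fun φ => by simpa using hτ

theorem isStatOracle_confusingOracle {τ : ℝ} (hτ : 0 ≤ τ) (Q P : X → ℝ) :
    IsStatOracle τ P (confusingOracle τ Q P) := by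
  intro φ
  unfold confusingOracle
  split_ifs with h
  · simpa using hτ
  · rw [abs_sub_comm]
    exact not_lt.1 h

theorem measurableSet_distinguish (τ : ℝ) :
    MeasurableSet {p : ((X → ℝ) × (X → ℝ)) × Query X | τ < |expect p.1.2 p.2 - expect p.1.1 p.2|} :=
  measurableSet_lt measurable_const (((measurable_expect.comp
    ((measurable_snd.comp measurable_fst).prodMk measurable_snd)).sub (measurable_expect.comp
    ((measurable_fst.comp measurable_fst).prodMk measurable_snd))).norm)

theorem measurable_distinguish (τ : ℝ) (Q : X → ℝ) :
    Measurable fun p : (X → ℝ) × Query X => distinguish τ Q p.1 p.2 := by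
  have h : (fun p : (X → ℝ) × Query X => distinguish τ Q p.1 p.2)
      = {p : (X → ℝ) × Query X | τ < |expect p.1 p.2 - expect Q p.2|}.indicator 1 := rfl
  rw [h]
  exact measurable_one.indicator (((measurable_const.prodMk measurable_fst).prodMk measurable_snd)
    (measurableSet_distinguish (X := X) τ))

theorem measurable_confusingOracle (τ : ℝ) (Q P : X → ℝ) :
    Measurable (confusingOracle τ Q P) :=
  Measurable.ite ((measurable_const (a := (Q, P))).prodMk measurable_id
    (measurableSet_distinguish (X := X) τ)) (measurable_expect_right P) (measurable_expect_right Q)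

/-- A correct algorithm, run with the exact oracle for `Q`, asks a query that distinguishes `P`
from `Q`. -/
theorem SQAlgorithm.Correct.one_le_queryWeight {A : SQAlgorithm X} {τ : ℝ} (hτ : 0 ≤ τ) {q : ℕ}
    {Q P : X → ℝ} (hQ : A.Correct τ q Q Q) (hP : A.Correct τ q Q P) (hne : P ≠ Q) :
    1 ≤ A.queryWeight (expect Q) (distinguish τ Q P) q 0 Fin.elim0 := by
  -- The two oracles differ only on distinguishing queries, while `P ≠ Q` makes the required
  -- verdicts opposite.
  refine A.one_le_queryWeight (O' := confusingOracle τ Q P) ?_ q 0 _ ?_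
  · intro φ hφ
    have : τ < |expect P φ - expect Q φ| := by
      by_contra h
      simp [confusingOracle, h] at hφ
    simp [distinguish, this]
  · have h1 := hQ _ (isStatOracle_expect hτ Q)
    have h2 := hP _ (isStatOracle_confusingOracle hτ Q P)
    rw [run] at h1 h2
    simp [h1, h2, correctVerdict, hne]

/-- The randomized version: the exact run on `Q` distinguishes `P` from `Q` with probability at
least `2α - 1`. -/
theorem RandomizedSQAlgorithm.Correct.le_lintegral_queryWeight {A : RandomizedSQAlgorithm Ω X}
    {ℙ : Measure Ω} [IsProbabilityMeasure ℙ] {τ : ℝ} (hτ : 0 ≤ τ) {q : ℕ} {α : ℝ}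
    {Q P : X → ℝ} (hQ : A.Correct ℙ τ q α Q Q) (hP : A.Correct ℙ τ q α Q P) (hne : P ≠ Q) :
    ENNReal.ofReal (2 * α - 1) ≤
      ∫⁻ ω, (A.alg ω).queryWeight (expect Q) (distinguish τ Q P) q 0 Fin.elim0 ∂ℙ := by
  have hmQ := measurable_expect_right Q
  have hmP := measurable_confusingOracle τ Q P
  have h1 := hQ _ hmQ (isStatOracle_expect hτ Q)
  have h2 := hP _ hmP (isStatOracle_confusingOracle hτ Q P)
  set S := {ω | (A.alg ω).run (expect Q) q = some (correctVerdict Q Q)}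
  set S' := {ω | (A.alg ω).run (confusingOracle τ Q P) q = some (correctVerdict P Q)}
  have hS' : MeasurableSet S' := A.measurableSet_run_eq hmP _ q
  -- Inclusion–exclusion for two events of probability at least `α`.
  have h3 : 2 * α - 1 ≤ ℙ.real (S ∩ S') := by
    have := measureReal_union_add_inter (μ := ℙ) (s := S) hS'
    have := measureReal_le_one (μ := ℙ) (s := S ∪ S')
    linarith
  refine (ENNReal.ofReal_le_ofReal h3).trans ?_
  rw [ofReal_measureReal, ← lintegral_indicator_one
    ((A.measurableSet_run_eq hmQ _ q).inter hS')]
  refine lintegral_mono fun ω => ?_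
  by_cases hω : ω ∈ S ∩ S'
  · rw [Set.indicator_of_mem hω]
    refine (A.alg ω).one_le_queryWeight (O' := confusingOracle τ Q P) ?_ q 0 _ ?_
    · intro φ hφ
      have : τ < |expect P φ - expect Q φ| := by
        by_contra h
        simp [confusingOracle, h] at hφ
      simp [distinguish, this]
    · have e1 : (A.alg ω).run (expect Q) q = _ := hω.1
      have e2 : (A.alg ω).run (confusingOracle τ Q P) q = _ := hω.2
      rw [SQAlgorithm.run] at e1 e2
      simp [e1, e2, correctVerdict, hne]
  · rw [Set.indicator_of_notMem hω]
    exact zero_le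

end Runs

/-! ### The query lower bounds -/

namespace SphereEnsemble

open scoped ENNReal

variable {M d : ℕ} {X : Type*} [Fintype X] {t δ C_G : ℝ}

theorem measurable_outputDist_pi (E : SphereEnsemble M d X t δ C_G) : Measurable E.outputDist :=
  measurable_pi_iff.2 E.measurable_outputDist

theorem measurable_distinguish_outputDist (E : SphereEnsemble M d X t δ C_G) (τ : ℝ) :
    Measurable fun p : ParamSphere M × Query X =>
      distinguish τ E.refDist (E.outputDist p.1) p.2 :=
  Measurable.comp (g := fun p : (X → ℝ) × Query X => distinguish τ E.refDist p.1 p.2)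
    (f := fun p : ParamSphere M × Query X => (E.outputDist p.1, p.2))
    (measurable_distinguish τ E.refDist) ((E.measurable_outputDist_pi.comp measurable_fst).prodMk measurable_snd)

theorem measurable_distinguish_outputDist_left (E : SphereEnsemble M d X t δ C_G) (τ : ℝ)
    (φ : Query X) : Measurable fun θ => distinguish τ E.refDist (E.outputDist θ) φ :=
  Measurable.comp (f := fun θ : ParamSphere M => (θ, φ)) (E.measurable_distinguish_outputDist τ)
    (measurable_id.prodMk measurable_const)

theorem lintegral_distinguish_le_frac (E : SphereEnsemble M d X t δ C_G) (τ : ℝ) (φ : Query X) :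
    ∫⁻ θ, distinguish τ E.refDist (E.outputDist θ) φ ∂E.paramLaw ≤ E.frac τ := by
  have h : (fun θ => distinguish τ E.refDist (E.outputDist θ) φ)
      = {θ | τ < |expect (E.outputDist θ) φ - expect E.refDist φ|}.indicator 1 := rfl
  rw [h]
  refine (lintegral_indicator_one_le _).trans ?_
  exact (measure_mono fun θ (hθ : τ < _) => hθ.le).trans
    (le_iSup (fun φ : Query X =>
      E.paramLaw {θ | τ ≤ |expect (E.outputDist θ) φ - expect E.refDist φ|}) φ)

/-- A deterministic algorithm needs `β / frac τ` queries. -/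
theorem DetDecides.le_mul_frac {E : SphereEnsemble M d X t δ C_G} {A : SQAlgorithm X}
    {τ : ℝ} (hτ : 0 ≤ τ) {q : ℕ} {β : ℝ} (h : E.DetDecides A τ q β)
    (h0 : E.paramLaw {θ | E.outputDist θ = E.refDist} = 0) :
    ENNReal.ofReal β ≤ q * E.frac τ := by
  have hD : ∀ φ, Measurable fun θ => distinguish τ E.refDist (E.outputDist θ) φ := fun φ =>
    E.measurable_distinguish_outputDist_left τ φ
  refine (ENNReal.ofReal_le_ofReal h.2).trans ?_
  rw [ofReal_measureReal]
  refine le_trans ?_ (A.lintegral_queryWeight_le E.paramLaw (expect E.refDist) hD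
    (E.lintegral_distinguish_le_frac τ) q 0 Fin.elim0)
  -- Markov's inequality at level one. The set of `θ` on which `A` succeeds need not be measurable,
  -- since monotonicity of the outer measure suffices.
  refine le_trans ?_ (mul_meas_ge_le_lintegral
    (A.measurable_queryWeight (expect E.refDist) hD q 0 Fin.elim0) 1)
  rw [one_mul]
  refine measure_mono_ae ?_
  filter_upwards [measure_eq_zero_iff_ae_notMem.1 h0] with θ hne hθ
  exact h.1.one_le_queryWeight hτ hθ hne

/-- A randomized algorithm needs `(2α - 1) β / frac τ` queries. -/
theorem RandDecides.le_mul_frac {E : SphereEnsemble M d X t δ C_G} {Ω : Type*}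
    [MeasurableSpace Ω] {ℙ : Measure Ω} [IsProbabilityMeasure ℙ] {A : RandomizedSQAlgorithm Ω X}
    {τ : ℝ} (hτ : 0 ≤ τ) {q : ℕ} {α β : ℝ} (h : E.RandDecides ℙ A τ q α β)
    (h0 : E.paramLaw {θ | E.outputDist θ = E.refDist} = 0) :
    ENNReal.ofReal (2 * α - 1) * ENNReal.ofReal β ≤ q * E.frac τ := by
  have hD := E.measurable_distinguish_outputDist τ
  have hW : Measurable fun p : Ω × ParamSphere M => (A.alg p.1).queryWeight (expect E.refDist)
      (distinguish τ E.refDist (E.outputDist p.2)) q 0 Fin.elim0 :=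
    Measurable.comp
      (f := fun p : Ω × ParamSphere M => (p, (Fin.elim0 : Fin 0 → ℝ)))
      (A.measurable_queryWeight (D := fun θ => distinguish τ E.refDist (E.outputDist θ))
        (measurable_expect_right E.refDist) hD q 0)
      (measurable_id.prodMk measurable_const)
  have hβ : ENNReal.ofReal β ≤ E.paramLaw {θ | ENNReal.ofReal (2 * α - 1) ≤
      ∫⁻ ω, (A.alg ω).queryWeight (expect E.refDist)
        (distinguish τ E.refDist (E.outputDist θ)) q 0 Fin.elim0 ∂ℙ} := by
    refine (ENNReal.ofReal_le_ofReal h.2).trans ?_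
    rw [ofReal_measureReal]
    refine measure_mono_ae ?_
    filter_upwards [measure_eq_zero_iff_ae_notMem.1 h0] with θ hne hθ
    exact h.1.le_lintegral_queryWeight hτ hθ hne
  -- Markov in `θ` at level `2α - 1`; after Tonelli, the deterministic weight bound applies for each
  -- fixed `ω`.
  calc ENNReal.ofReal (2 * α - 1) * ENNReal.ofReal β
      ≤ ENNReal.ofReal (2 * α - 1) * E.paramLaw {θ | ENNReal.ofReal (2 * α - 1) ≤
        ∫⁻ ω, (A.alg ω).queryWeight (expect E.refDist)
          (distinguish τ E.refDist (E.outputDist θ)) q 0 Fin.elim0 ∂ℙ} :=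
      mul_le_mul_right hβ _
    _ ≤ ∫⁻ θ, ∫⁻ ω, (A.alg ω).queryWeight (expect E.refDist)
        (distinguish τ E.refDist (E.outputDist θ)) q 0 Fin.elim0 ∂ℙ ∂E.paramLaw :=
      mul_meas_ge_le_lintegral hW.lintegral_prod_left' _
    _ = ∫⁻ ω, ∫⁻ θ, (A.alg ω).queryWeight (expect E.refDist)
        (distinguish τ E.refDist (E.outputDist θ)) q 0 Fin.elim0 ∂E.paramLaw ∂ℙ :=
      (lintegral_lintegral_swap hW.aemeasurable).symm
    _ ≤ ∫⁻ _, q * E.frac τ ∂ℙ := lintegral_mono fun ω =>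
      (A.alg ω).lintegral_queryWeight_le E.paramLaw (expect E.refDist)
        (E.measurable_distinguish_outputDist_left τ)
        (E.lintegral_distinguish_le_frac τ) q 0 Fin.elim0
    _ = q * E.frac τ := by simp

/-- The concentration bound turns a lower bound on `q * frac τ` into a lower bound on `q`. -/
theorem ConcentrationBound.mul_exp_le {E : SphereEnsemble M d X t δ C_G} {c_par τ : ℝ}
    (hE : E.ConcentrationBound c_par) (hτ : 0 < τ) {q : ℕ} {b : ℝ}
    (h : ENNReal.ofReal b ≤ q * E.frac τ) :
    b / 2 * Real.exp (c_par * τ ^ 2 / (t * δ * C_G) ^ 2 * M) ≤ q := by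
  have h1 := h.trans (mul_le_mul_right (hE τ hτ) (q : ℝ≥0∞))
  rw [← ENNReal.ofReal_natCast, ← ENNReal.ofReal_mul (by positivity),
    ENNReal.ofReal_le_ofReal_iff (by positivity)] at h1
  rw [show c_par * (M * τ ^ 2 / (t * δ * C_G) ^ 2) = c_par * τ ^ 2 / (t * δ * C_G) ^ 2 * M by ring,
    Real.exp_neg] at h1
  set y := Real.exp (c_par * τ ^ 2 / (t * δ * C_G) ^ 2 * M)
  have hy : 0 < y := Real.exp_pos _
  calc b / 2 * y ≤ q * (2 * y⁻¹) / 2 * y := by gcongr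
    _ = q := by field_simp

end SphereEnsemble

/-- Eventually the mean total variation distance is positive. -/
theorem PorterThomasMean.eventually_pos {M d : ℕ → ℕ} {X : ℕ → Type*} [∀ n, Fintype (X n)]
    {t δ C_G : ℝ} {E : ∀ n, SphereEnsemble (M n) (d n) (X n) t δ C_G} (h : PorterThomasMean E) :
    ∀ᶠ n in atTop, 0 < (E n).meanTV := by
  obtain ⟨m₀, hm₀, ε, -, hε, hE⟩ := h
  filter_upwards [hε.eventually_lt_const hm₀] with n hn
  have := (hE n).1
  linarith

end LindbladSQ

end

/-! ### The asymptotic lower bounds. -/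

theorem mainTheorem3
    (t δ C_G c_par τ : ℝ) (ht : 0 < t) (hδ : 0 < δ) (hC : 0 < C_G) (hc : 0 < c_par)
    (hτ : τ ∈ Set.Ioo (0 : ℝ) 1) :
    ∃ c : ℝ, 0 < c ∧
      ∀ (M d : ℕ → ℕ) (X : ℕ → Type*) [∀ n, Fintype (X n)]
        (E : ∀ n, LindbladSQ.SphereEnsemble (M n) (d n) (X n) t δ C_G),
        Tendsto M atTop atTop →
        (∀ n, (E n).ConcentrationBound c_par) →
        LindbladSQ.PorterThomasMean E →
        ∀ β ∈ Set.Ioo (0 : ℝ) 1,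
          (∀ᶠ n in atTop, ∀ (q : ℕ) (A : LindbladSQ.SQAlgorithm (X n)),
            (E n).DetDecides A τ q β → β * Real.exp (c * M n) ≤ q) ∧
          (∀ α : ℝ, 1 / 2 < α →
            ∀ᶠ n in atTop, ∀ (q : ℕ) (Ω : Type*) [MeasurableSpace Ω] (ℙ : Measure Ω)
              [IsProbabilityMeasure ℙ] (A : LindbladSQ.RandomizedSQAlgorithm Ω (X n)),
              (E n).RandDecides ℙ A τ q α β →
                (α - 1 / 2) * β * Real.exp (c * M n) ≤ q) := by
  have hL : 0 < t * δ * C_G := by positivity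
  have hτ0 := hτ.1
  set K := c_par * τ ^ 2 / (t * δ * C_G) ^ 2 with hK
  have hK0 : 0 < K := by positivity
  -- Half of the exponent `K` is given up to absorb the factor 2 of the concentration bound in the
  -- deterministic case.
  refine ⟨K / 2, by positivity, fun M d X _ E hM hconc hPT β hβ => ?_⟩
  have hnull : ∀ᶠ n in atTop,
      (E n).paramLaw {θ | (E n).outputDist θ = (E n).refDist} = 0 := by
    filter_upwards [hM.eventually_ge_atTop 2, hPT.eventually_pos] with n h2 hpos
    exact (E n).paramLaw_eq_refDist_eq_zero h2 hpos
  refine ⟨?_, fun α hα => ?_⟩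
  · have hexp : ∀ᶠ n in atTop, 2 ≤ Real.exp (K / 2 * M n) :=
      (Real.tendsto_exp_atTop.comp ((tendsto_natCast_atTop_atTop.comp hM).const_mul_atTop
        (half_pos hK0))).eventually_ge_atTop 2
    filter_upwards [hnull, hexp] with n h0 h2 q A hA
    refine le_trans ?_ ((hconc n).mul_exp_le hτ0 (hA.le_mul_frac hτ0.le h0))
    rw [← hK, show K * M n = K / 2 * M n + K / 2 * M n by ring, Real.exp_add]
    have h3 : 0 ≤ β * Real.exp (K / 2 * M n) := mul_nonneg hβ.1.le (Real.exp_pos _).le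
    nlinarith [mul_le_mul_of_nonneg_left h2 h3]
  · filter_upwards [hnull] with n h0 q Ω _ ℙ _ A hA
    have h := hA.le_mul_frac hτ0.le h0
    rw [← ENNReal.ofReal_mul (by linarith)] at h
    refine le_trans ?_ ((hconc n).mul_exp_le hτ0 h)
    -- Here the factor 2 is already accounted for by `α - 1/2`, so only `K / 2 ≤ K` is needed.
    rw [← hK, show (2 * α - 1) * β / 2 = (α - 1 / 2) * β by ring]
    have h1 : 0 ≤ (α - 1 / 2) * β := mul_nonneg (by linarith) hβ.1.le
    gcongr
    linarith
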